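/- Let $E$ be a finite-dimensional real inner product space. A polytope $P\subset E$ is the convex hull of a finite set of points; its dimension is the dimension of its affine span. A face of $P$ is a nonempty set of the form $\{x\in P:\ \ell(x)=\max_P \ell\}$ for a linear functional $\ell$ on $E$ ($\ell=0$ is allowed, so a nonempty $P$ is a face of itself). Vertices and edges are the faces of dimension $0$ and $1$, and a polytope of dimension $d$ is called simple if each of its vertices lies on exactly $d$ edges. A polytope is called non-acute (resp. obtuse) in codimension $1$ if at every face of codimension $2$ the (interior) dihedral angle between the two codimension $1$ faces meeting there is at least (resp. greater than) $\pi/2$. A polytope is called non-acute (resp. obtuse) if it and all of its faces, of every dimension, considered as polytopes in their own right, are non-acute (resp. obtuse) in codimension $1$. Proposition. Let $P$ be a polytope in $E$. (a) $P$ is non-acute if and only if every $2$-dimensional face of $P$ is non-acute. (b) $P$ is obtuse if and only if every $2$-dimensional face of $P$ is obtuse. (c) If $P$ is non-acute, then $P$ is simple. -/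

import Mathlib

namespace EuclideanPolytope

variable {E : Type*} [NormedAddCommGroup E] [InnerProductSpace ℝ E]

/-- A polytope is the convex hull of a finite set of points. -/
def IsPolytope (P : Set E) : Prop :=
  ∃ s : Finset E, P = convexHull ℝ (s : Set E)

/-- The dimension of a (nonempty) set is the dimension of the smallest affine subspace
containing it. -/
noncomputable def dim (S : Set E) : ℕ :=
  Module.finrank ℝ (affineSpan ℝ S).direction

/-- `F` is a (nonempty) face of `P`: the set of maximizers over `P` of some linear functional.
The zero functional is allowed, so a nonempty `P` is a face of itself. -/
def IsFace (P F : Set E) : Prop :=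
  F.Nonempty ∧ IsExposed ℝ P F

/-- A polytope is simple if every vertex (face `{v}`) lies on exactly `dim P` edges
(`1`-dimensional faces). -/
def IsSimple (P : Set E) : Prop :=
  ∀ v : E, IsFace P {v} →
    {e : Set E | IsFace P e ∧ dim e = 1 ∧ v ∈ e}.encard = dim P

variable [FiniteDimensional ℝ E]

/-- `θ` is the dihedral angle at `G` between `F₁` and `F₂`, where `G` is a face of codimension one
in both `F₁` and `F₂`: the angle between the directions orthogonal to `G` that point from `G`
into `F₁` and into `F₂`.  Modulo positive factors, the direction pointing into `F₁` is the
orthogonal projection of `x - p` to the orthogonal complement of the direction space of `G`, for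
any `p ∈ G` and any `x ∈ F₁` outside `G`; the angle is independent of these choices. -/
def IsDihedralAngle (G F₁ F₂ : Set E) (θ : ℝ) : Prop :=
  ∃ p ∈ G, ∃ x ∈ F₁ \ G, ∃ y ∈ F₂ \ G,
    θ = InnerProductGeometry.angle
      ((affineSpan ℝ G).directionᗮ.starProjection (x - p))
      ((affineSpan ℝ G).directionᗮ.starProjection (y - p))

/-- `θ` is the dihedral angle of `P` at some codimension `2` face `G`, between the two codimension
`1` faces `F₁`, `F₂` of `P` that meet there. -/
def IsDihedralAngleOf (P : Set E) (θ : ℝ) : Prop :=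
  ∃ G F₁ F₂ : Set E,
    IsFace P G ∧ dim G + 2 = dim P ∧
    IsFace P F₁ ∧ dim F₁ + 1 = dim P ∧
    IsFace P F₂ ∧ dim F₂ + 1 = dim P ∧
    F₁ ≠ F₂ ∧ G ⊆ F₁ ∧ G ⊆ F₂ ∧
    IsDihedralAngle G F₁ F₂ θ

/-- All dihedral angles of `P` at its codimension `2` faces are at least `π / 2`. -/
def IsNonAcuteInCodimOne (P : Set E) : Prop :=
  ∀ θ : ℝ, IsDihedralAngleOf P θ → Real.pi / 2 ≤ θ

/-- All dihedral angles of `P` at its codimension `2` faces are greater than `π / 2`. -/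
def IsObtuseInCodimOne (P : Set E) : Prop :=
  ∀ θ : ℝ, IsDihedralAngleOf P θ → Real.pi / 2 < θ

/-- `P` and all of its faces, as polytopes in their own right, are non-acute in
codimension `1`. -/
def IsNonAcute (P : Set E) : Prop :=
  IsNonAcuteInCodimOne P ∧ ∀ F : Set E, IsFace P F → IsNonAcuteInCodimOne F

/-- `P` and all of its faces, as polytopes in their own right, are obtuse in
codimension `1`. -/
def IsObtuse (P : Set E) : Prop :=
  IsObtuseInCodimOne P ∧ ∀ F : Set E, IsFace P F → IsObtuseInCodimOne F

end EuclideanPolytope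

/-! Everything happens in the tangent cone of `P` at a vertex `v`. This cone is pointed, so it is
generated by its finitely many exposed rays, the edge directions at `v`, normalized to height one
for a functional `h`.

The key claim is that if all 2-faces are non-acute, any two distinct edge directions `y`, `z`
satisfy `⟪y, z⟫ ≤ 0`. When `y` and `z` span a 2-face, this is its angle condition at `v`. In
general, dividing the cone by the line through `y` shows that `z = a • y + w` with `w` in the cone
of the neighbors of `y`, and `a ≤ 0` because `z` is itself an exposed ray (`IsRay.exists_decomp`).
Pairing with `y` gives the claim, and strictness survives in the obtuse case.

Vectors in an open half-space with pairwise nonpositive inner products are linearly independent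
(`linearIndependent_of_inner_nonpos`). So the number of edges at `v` is the dimension, which is (c),
and the dimension of a face through `v` counts its edges at `v`. A codimension 2 face `G` and the
two facets around it thus have edge sets `A`, `A ∪ {a}`, `A ∪ {b}` at a vertex of `G`. The dihedral
angle is that between the projections of `a` and `b` orthogonal to `A`, and this projection does not
increase `⟪a, b⟫` (`inner_starProjection_orthogonal_le`). This gives (a) and (b), as faces of faces
are faces. -/

namespace EuclideanPolytope

open scoped NNReal InnerProductSpace

/-! ### Finitely generated cones and their exposed rays -/

section Cone

variable {E : Type*} [NormedAddCommGroup E] [InnerProductSpace ℝ E]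

/-- The conical hull of a set. -/
abbrev cone (S : Set E) : Submodule ℝ≥0 E := Submodule.span ℝ≥0 S

theorem smul_mem_cone {S : Set E} {c : ℝ} (hc : 0 ≤ c) {x : E} (hx : x ∈ cone S) :
    c • x ∈ cone S :=
  (cone S).smul_mem (⟨c, hc⟩ : ℝ≥0) hx

theorem cone_nonneg {S : Set E} {l : E →ₗ[ℝ] ℝ} (hl : ∀ x ∈ S, 0 ≤ l x) {x : E}
    (hx : x ∈ cone S) : 0 ≤ l x := by
  induction hx using Submodule.span_induction with
  | mem x hx => exact hl x hx
  | zero => simp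
  | add x y _ _ hx hy => rw [map_add]; exact add_nonneg hx hy
  | smul c x _ hx =>
    rw [NNReal.smul_def, map_smul, smul_eq_mul]
    exact mul_nonneg c.2 hx

theorem cone_pos {S : Set E} {l : E →ₗ[ℝ] ℝ} (hl : ∀ x ∈ S, 0 < l x) {x : E}
    (hx : x ∈ cone S) : x = 0 ∨ 0 < l x := by
  induction hx using Submodule.span_induction with
  | mem x hx => exact Or.inr (hl x hx)
  | zero => simp
  | add x y _ _ hx hy =>
    rcases hx with rfl | hx
    · simpa using hy
    rcases hy with rfl | hy
    · right; simpa using hx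
    · right; rw [map_add]; exact add_pos hx hy
  | smul c x _ hx =>
    rcases hx with rfl | hx
    · simp
    rcases eq_or_ne c 0 with rfl | hc
    · simp
    right
    rw [NNReal.smul_def, map_smul, smul_eq_mul]
    exact mul_pos (by positivity) hx

/-- A sum of nonnegative terms vanishes only if each term does, so only generators in the kernel can
contribute. -/
theorem mem_cone_ker {S : Set E} {l : E →ₗ[ℝ] ℝ} (hl : ∀ x ∈ S, 0 ≤ l x) {x : E}
    (hx : x ∈ cone S) (h0 : l x = 0) : x ∈ cone {y ∈ S | l y = 0} := by
  induction hx using Submodule.span_induction with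
  | mem x hx => exact Submodule.subset_span ⟨hx, h0⟩
  | zero => exact zero_mem _
  | add x y hx' hy' hx hy =>
    have h1 := cone_nonneg hl hx'
    have h2 := cone_nonneg hl hy'
    rw [map_add] at h0
    exact add_mem (hx (by linarith)) (hy (by linarith))
  | smul c x _ hx =>
    rw [NNReal.smul_def, map_smul, smul_eq_mul, mul_eq_zero] at h0
    rcases h0 with h0 | h0
    · have : c = 0 := by exact_mod_cast h0
      simp [this]
    · exact Submodule.smul_mem _ _ (hx h0)

theorem mem_span_of_mem_cone {S : Set E} {x : E} (hx : x ∈ cone S) :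
    x ∈ Submodule.span ℝ S :=
  Submodule.span_le_restrictScalars ℝ≥0 ℝ S hx

theorem mem_cone_of_subset_cone {S T : Set E} (h : S ⊆ cone T) {x : E} (hx : x ∈ cone S) :
    x ∈ cone T :=
  Submodule.span_le.2 h hx

/-- `y` lies on an exposed ray of the cone generated by `S`. -/
def IsRay (S : Set E) (y : E) : Prop :=
  y ∈ S ∧ ∃ l : E →ₗ[ℝ] ℝ, (∀ x ∈ S, 0 ≤ l x) ∧ l y = 0 ∧
    ∀ x ∈ S, l x = 0 → x ∈ Submodule.span ℝ {y}

/-- Lets `k` dominate `l` lexicographically on a finite set, so that a face of a face is exposed by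
the single functional `M • k + l`. -/
theorem exists_forall_pos_mul_add {ι : Type*} {S : Set ι} (hS : S.Finite) (k l : ι → ℝ) :
    ∃ M : ℝ, ∀ x ∈ S, 0 < k x → 0 < M * k x + l x := by
  obtain ⟨M, hM⟩ := (hS.image fun x => -l x / k x).bddAbove
  refine ⟨M + 1, fun x hx hk => ?_⟩
  have h1 : -l x / k x ≤ M := hM ⟨x, hx, rfl⟩
  rw [div_le_iff₀ hk] at h1
  linarith

theorem IsRay.of_face {S : Set E} (hS : S.Finite) {k : E →ₗ[ℝ] ℝ} (hk : ∀ x ∈ S, 0 ≤ k x)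
    {y : E} (hy : IsRay {x ∈ S | k x = 0} y) : IsRay S y := by
  obtain ⟨⟨hyS, hky⟩, l, hl, hly, hl0⟩ := hy
  obtain ⟨M, hM⟩ := exists_forall_pos_mul_add hS k l
  refine ⟨hyS, M • k + l, fun x hx => ?_, by simp [hky, hly], fun x hx h0 => ?_⟩
  · rcases (hk x hx).eq_or_lt with h | h
    · simpa [← h] using hl x ⟨hx, h.symm⟩
    · simpa using (hM x hx h).le
  · rcases (hk x hx).eq_or_lt with h | h
    · exact hl0 x ⟨hx, h.symm⟩ (by simpa [← h] using h0)
    · have := hM x hx h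
      simp at h0
      linarith

/-- On the slice `h = 1`, a point `w` of maximal norm is exposed by the tangent hyperplane to the
sphere through it, that is, by `‖w‖ ^ 2 • h - ⟪w, ·⟫`. -/
theorem exists_isRay {S : Set E} (hS : S.Finite) (hne : S.Nonempty) {h : E →ₗ[ℝ] ℝ}
    (hh : ∀ x ∈ S, 0 < h x) : ∃ y, IsRay S y := by
  obtain ⟨y, hy, hmax⟩ := Set.exists_max_image S (fun x => ‖(h x)⁻¹ • x‖) hS hne
  set w := (h y)⁻¹ • y with hw
  have key : ∀ x ∈ S, ‖(h x)⁻¹ • x - w‖ ^ 2 ≤ 2 * (‖w‖ ^ 2 - (h x)⁻¹ * ⟪w, x⟫_ℝ) := by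
    intro x hx
    have h1 := hmax x hx
    have h2 : ‖(h x)⁻¹ • x‖ ^ 2 ≤ ‖w‖ ^ 2 := by gcongr
    rw [norm_sub_sq_real, real_inner_comm, inner_smul_right]
    linarith
  refine ⟨y, hy, ‖w‖ ^ 2 • h - (innerₗ E w), fun x hx => ?_, ?_, fun x hx h0 => ?_⟩
  · have h1 := (sq_nonneg _).trans (key x hx)
    have h2 := mul_nonneg (hh x hx).le h1
    have h3 : h x * (2 * (‖w‖ ^ 2 - (h x)⁻¹ * ⟪w, x⟫_ℝ)) = 2 * (‖w‖ ^ 2 * h x - ⟪w, x⟫_ℝ) := by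
      field_simp [(hh x hx).ne']
    simp
    linarith
  · have h3 : y = h y • w := by rw [hw, smul_inv_smul₀ (hh y hy).ne']
    have : ⟪w, y⟫_ℝ = h y * ‖w‖ ^ 2 := by
      conv_lhs => rw [h3]
      rw [inner_smul_right, real_inner_self_eq_norm_sq]
    simp [this]; ring
  · have h1 := key x hx
    have h2 : ‖w‖ ^ 2 - (h x)⁻¹ * ⟪w, x⟫_ℝ = 0 := by
      simp at h0
      have h4 : ⟪w, x⟫_ℝ = ‖w‖ ^ 2 * h x := by linarith
      rw [h4]; field_simp [(hh x hx).ne']; ring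
    rw [h2, mul_zero] at h1
    have h5 : (h x)⁻¹ • x = w := by
      rw [← sub_eq_zero, ← norm_eq_zero]
      exact pow_eq_zero_iff two_ne_zero |>.1 (le_antisymm h1 (sq_nonneg _))
    rw [Submodule.mem_span_singleton]
    refine ⟨h x * (h y)⁻¹, ?_⟩
    rw [mul_smul, ← hw, ← h5, smul_inv_smul₀ (hh x hx).ne']

/-- A finitely generated pointed cone is generated by its exposed rays. -/
theorem mem_cone_rays {S : Set E} (hS : S.Finite) {h : E →ₗ[ℝ] ℝ}
    (hh : ∀ x ∈ S, 0 < h x) {x : E} (hx : x ∈ S) : x ∈ cone {y | IsRay S y} := by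
  set R := {y | IsRay S y}
  have hRS : R ⊆ S := fun y hy => hy.1
  set K := convexHull ℝ ((fun y => (h y)⁻¹ • y) '' R)
  have hK : K ⊆ cone R := by
    refine convexHull_min ?_ ?_
    · rintro _ ⟨y, hy, rfl⟩
      exact smul_mem_cone (inv_nonneg.2 (hh y (hRS hy)).le) (Submodule.subset_span hy)
    · intro a ha b hb s t hs ht _
      exact add_mem (smul_mem_cone hs ha) (smul_mem_cone ht hb)
  by_contra hcon
  have hxK : (h x)⁻¹ • x ∉ K := by
    intro hmem
    apply hcon
    have := smul_mem_cone (hh x hx).le (hK hmem)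
    rwa [smul_inv_smul₀ (hh x hx).ne'] at this
  have hKc : IsClosed K := (((hS.subset hRS).image _).isCompact_convexHull ℝ).isClosed
  obtain ⟨f, u, hf, hfx⟩ := geometric_hahn_banach_closed_point (convex_convexHull ℝ _) hKc hxK
  set l : E →ₗ[ℝ] ℝ := u • h - f.toLinearMap with hl
  have hlx : l x < 0 := by
    rw [map_smul, smul_eq_mul, inv_mul_eq_div, lt_div_iff₀ (hh x hx)] at hfx
    simp [hl]; linarith
  have hlR : ∀ y ∈ R, 0 < l y := by
    intro y hy
    have := hf _ (subset_convexHull ℝ _ ⟨y, hy, rfl⟩)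
    simp only [map_smul, smul_eq_mul] at this
    rw [inv_mul_eq_div, div_lt_iff₀ (hh y (hRS hy))] at this
    simp [hl]; linarith
  -- The separating `l` is positive on all rays but negative at `x`. The face where `l / h` attains
  -- its negative minimum contains a ray, which is also a ray of `S`: a contradiction.
  obtain ⟨z, hz, hmin⟩ := Set.exists_min_image S (fun x => l x / h x) hS ⟨x, hx⟩
  set m := l z / h z with hm
  have hm0 : m < 0 := (hmin x hx).trans_lt (div_neg_of_neg_of_pos hlx (hh x hx))
  have hk : ∀ y ∈ S, 0 ≤ (l - m • h) y := by
    intro y hy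
    have := hmin y hy
    rw [le_div_iff₀ (hh y hy)] at this
    simp; linarith
  have hkz : (l - m • h) z = 0 := by
    simp [hm, div_mul_cancel₀ _ (hh z hz).ne']
  obtain ⟨y, hy⟩ := exists_isRay (hS.subset (Set.sep_subset S fun y => (l - m • h) y = 0))
    ⟨z, hz, hkz⟩ (fun x hx => hh x hx.1)
  have h1 := hlR y (hy.of_face hS hk)
  have h2 := hy.1.2
  have h3 := mul_neg_of_neg_of_pos hm0 (hh y hy.1.1)
  simp at h2
  linarith

/-! ### Adjacent rays and the comparison of arbitrary pairs -/

theorem eq_of_mem_span_singleton {h : E →ₗ[ℝ] ℝ} {x y : E} (hx : h x = 1) (hy : h y = 1)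
    (hxy : x ∈ Submodule.span ℝ {y}) : x = y := by
  obtain ⟨c, rfl⟩ := Submodule.mem_span_singleton.1 hxy
  rw [map_smul, hy, smul_eq_mul, mul_one] at hx
  rw [hx, one_smul]

/-- The generators in `S` lying on an exposed ray other than that of `y`, but in a common
two-dimensional face with `y`. -/
def rayNeighbors (S : Set E) (y : E) : Set E :=
  {w | IsRay S w ∧ w ≠ y ∧ ∃ k : E →ₗ[ℝ] ℝ, (∀ x ∈ S, 0 ≤ k x) ∧ k y = 0 ∧ k w = 0 ∧
    Module.finrank ℝ (Submodule.span ℝ {x ∈ S | k x = 0}) = 2}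

/-- Modulo the line through `y` the cone remains pointed, since `ly` descends to it and is positive
on the remaining generators. Its rays come from 2-faces containing `y`, and each of these is
generated by `y` and neighbors of `y`. -/
theorem IsRay.exists_decomp {S : Set E} (hS : S.Finite) {h : E →ₗ[ℝ] ℝ}
    (hh : ∀ x ∈ S, h x = 1) {y z : E} (hy : IsRay S y) (hz : IsRay S z) (hyz : y ≠ z) :
    ∃ a : ℝ, a ≤ 0 ∧ ∃ w ∈ cone (rayNeighbors S y), z = a • y + w := by
  obtain ⟨hyS, ly, hly, hlyy, hly0⟩ := hy
  obtain ⟨hzS, lz, hlz, hlzz, hlz0⟩ := hz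
  have hpos : ∀ x ∈ S, 0 < h x := fun x hx => by rw [hh x hx]; exact one_pos
  have hly1 : ∀ x ∈ S, ly x = 0 → x = y := fun x hx h0 =>
    eq_of_mem_span_singleton (hh x hx) (hh y hyS) (hly0 x hx h0)
  set W := rayNeighbors S y
  -- `D` is the cone of the neighbors plus the whole line through `y`; the sign of the coefficient
  -- is settled only at the end.
  let D : Submodule ℝ≥0 E :=
    { carrier := {x | ∃ a : ℝ, x + a • y ∈ cone W}
      zero_mem' := ⟨0, by simp⟩
      add_mem' := by
        rintro p q ⟨a, ha⟩ ⟨b, hb⟩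
        refine ⟨a + b, ?_⟩
        have := add_mem ha hb
        rwa [show p + a • y + (q + b • y) = p + q + (a + b) • y by module] at this
      smul_mem' := by
        rintro c p ⟨a, ha⟩
        refine ⟨c * a, ?_⟩
        have := (cone W).smul_mem c ha
        rwa [smul_add, NNReal.smul_def c (a • y), smul_smul] at this }
  have hyD : ∀ {x : E} (c : ℝ), x + c • y ∈ D → x ∈ D := by
    rintro x c ⟨a, ha⟩
    exact ⟨c + a, by rwa [add_smul, ← add_assoc]⟩
  -- The quotient by `y` is realized as the projection along `y` onto the kernel of `h`.
  set π : E →ₗ[ℝ] E := LinearMap.id - h.smulRight y with hπ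
  have hπx : ∀ x, π x = x - h x • y := fun x => by simp [hπ]
  have hπy : π y = 0 := by rw [hπx, hh y hyS, one_smul, sub_self]
  have hlπ : ∀ x, ly (π x) = ly x := fun x => by rw [hπx]; simp [hlyy]
  set S' := π '' {s ∈ S | ly s ≠ 0} with hS'
  have hS'fin : S'.Finite := (hS.subset (Set.sep_subset _ _)).image _
  have hS'pos : ∀ x ∈ S', 0 < ly x := by
    rintro _ ⟨s, ⟨hs, hs0⟩, rfl⟩
    rw [hlπ]
    exact lt_of_le_of_ne (hly s hs) (Ne.symm hs0)
  have hrays : {t | IsRay S' t} ⊆ D := by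
    rintro _ ⟨⟨t, ⟨htS, ht0⟩, rfl⟩, k', hk', hk't, hk'0⟩
    have hkS : ∀ x ∈ S, 0 ≤ (k' ∘ₗ π) x := by
      intro x hx
      by_cases h0 : ly x = 0
      · rw [hly1 x hx h0]; simp [hπy]
      · exact hk' _ ⟨x, ⟨hx, h0⟩, rfl⟩
    have hspan : Submodule.span ℝ {x ∈ S | (k' ∘ₗ π) x = 0}
        = Submodule.span ℝ (Set.range ![y, t]) := by
      have hyt : y ∈ Submodule.span ℝ (Set.range ![y, t]) := Submodule.subset_span ⟨0, rfl⟩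
      have htt : t ∈ Submodule.span ℝ (Set.range ![y, t]) := Submodule.subset_span ⟨1, rfl⟩
      refine le_antisymm (Submodule.span_le.2 ?_) (Submodule.span_mono ?_)
      · rintro x ⟨hx, hx0⟩
        by_cases h0 : ly x = 0
        · rw [hly1 x hx h0]; exact hyt
        · obtain ⟨c, hc⟩ := Submodule.mem_span_singleton.1
            (hk'0 _ ⟨x, ⟨hx, h0⟩, rfl⟩ hx0)
          rw [hπx, hπx] at hc
          have : x = c • t + (h x - c * h t) • y := by
            rw [eq_comm, sub_eq_iff_eq_add] at hc
            rw [hc]; simp only [map_add, map_sub, map_smul, hh y hyS]; simp; module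
          rw [this]
          exact add_mem (Submodule.smul_mem _ _ htt) (Submodule.smul_mem _ _ hyt)
      · rintro _ ⟨i, rfl⟩
        fin_cases i
        · exact ⟨hyS, by simp [hπy]⟩
        · exact ⟨htS, hk't⟩
    have hind : LinearIndependent ℝ ![y, t] := by
      rw [LinearIndependent.pair_iff]
      intro a b hab
      have h1 := congrArg ly hab
      simp [hlyy, ht0] at h1
      have h2 := congrArg h hab
      simp [h1, hh y hyS] at h2
      exact ⟨h2, h1⟩
    have hrank : Module.finrank ℝ (Submodule.span ℝ {x ∈ S | (k' ∘ₗ π) x = 0}) = 2 := by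
      rw [hspan, finrank_span_eq_card hind, Fintype.card_fin]
    have htD : t ∈ D := by
      have h1 := mem_cone_rays (hS.subset (Set.sep_subset S fun x => (k' ∘ₗ π) x = 0))
        (fun x hx => hpos x hx.1) (x := t) ⟨htS, hk't⟩
      refine Submodule.span_le.2 ?_ h1
      intro w hw
      by_cases hwy : w = y
      · exact ⟨-1, by simp [hwy]⟩
      · refine ⟨0, ?_⟩
        rw [zero_smul, add_zero]
        exact Submodule.subset_span ⟨hw.of_face hS hkS, hwy, _, hkS, by simp [hπy], hw.1.2, hrank⟩
    refine hyD (h t) ?_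
    rwa [hπx, sub_add_cancel]
  have hlzy : ly z ≠ 0 := fun h0 => hyz (hly1 z hzS h0).symm
  have hzD : z ∈ D := by
    have h1 : π z ∈ D :=
      Submodule.span_le.2 hrays (mem_cone_rays hS'fin hS'pos ⟨z, ⟨hzS, hlzy⟩, rfl⟩)
    refine hyD (-h z) ?_
    rwa [neg_smul, ← sub_eq_add_neg, ← hπx]
  obtain ⟨a, ha⟩ := hzD
  refine ⟨-a, ?_, _, ha, by module⟩
  -- If `a < 0`, then `0 ≤ lz (z + a • y) = a * lz y` forces `lz y = 0`, which puts `y` on the ray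
  -- of `z`.
  by_contra! hneg
  have h1 : 0 ≤ lz (z + a • y) := cone_nonneg (fun x hx => hlz x hx.1.1) ha
  simp [hlzz] at h1
  have h2 : lz y = 0 := by nlinarith [hlz y hyS]
  exact hyz (eq_of_mem_span_singleton (hh y hyS) (hh z hzS) (hlz0 y hyS h2))

theorem IsRay.inner_nonpos {S : Set E} (hS : S.Finite) {h : E →ₗ[ℝ] ℝ}
    (hh : ∀ x ∈ S, h x = 1) {y z : E} (hy : IsRay S y) (hz : IsRay S z) (hyz : y ≠ z)
    (hN : ∀ w ∈ rayNeighbors S y, ⟪y, w⟫_ℝ ≤ 0) : ⟪y, z⟫_ℝ ≤ 0 := by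
  obtain ⟨a, ha, w, hw, rfl⟩ := hy.exists_decomp hS hh hz hyz
  have h1 : 0 ≤ (-innerₗ E y) w := cone_nonneg (fun x hx => by simpa using hN x hx) hw
  simp at h1
  rw [inner_add_right, inner_smul_right, real_inner_self_eq_norm_sq]
  nlinarith [sq_nonneg ‖y‖]

theorem IsRay.inner_neg {S : Set E} (hS : S.Finite) {h : E →ₗ[ℝ] ℝ}
    (hh : ∀ x ∈ S, h x = 1) {y z : E} (hy : IsRay S y) (hz : IsRay S z) (hyz : y ≠ z)
    (hN : ∀ w ∈ rayNeighbors S y, ⟪y, w⟫_ℝ < 0) : ⟪y, z⟫_ℝ < 0 := by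
  obtain ⟨a, ha, w, hw, rfl⟩ := hy.exists_decomp hS hh hz hyz
  -- If `w = 0`, then `z = a • y`, and comparing heights gives `a = 1`, contrary to `a ≤ 0`.
  rcases cone_pos (l := -innerₗ E y) (fun x hx => by simpa using hN x hx) hw with rfl | h1
  · have h1 := hh _ hz.1
    simp [hh y hy.1] at h1
    linarith
  simp at h1
  rw [inner_add_right, inner_smul_right, real_inner_self_eq_norm_sq]
  nlinarith [sq_nonneg ‖y‖]

end Cone

/-! ### Families with pairwise nonpositive inner products -/

section Nonpositive

variable {E : Type*} [NormedAddCommGroup E] [InnerProductSpace ℝ E]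

/-- The two sums have disjoint supports, so only products of distinct vectors survive. -/
theorem inner_sum_posPart_sum_negPart_nonpos {ι : Type*} [Fintype ι] {u : ι → E}
    (hu : ∀ i j, i ≠ j → ⟪u i, u j⟫_ℝ ≤ 0) (c : ι → ℝ) :
    ⟪∑ i, (c i)⁺ • u i, ∑ j, (c j)⁻ • u j⟫_ℝ ≤ 0 := by
  rw [sum_inner]
  refine Finset.sum_nonpos fun i _ => ?_
  rw [inner_sum]
  refine Finset.sum_nonpos fun j _ => ?_
  rw [inner_smul_left, inner_smul_right]
  simp only [conj_trivial]
  by_cases hij : i = j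
  · subst hij
    rcases le_total 0 (c i) with h | h
    · simp [negPart_eq_zero.2 h]
    · simp [posPart_eq_zero.2 h]
  · exact mul_nonpos_of_nonneg_of_nonpos (posPart_nonneg _)
      (mul_nonpos_of_nonneg_of_nonpos (negPart_nonneg _) (hu i j hij))

theorem sum_posPart_sub_sum_negPart {ι : Type*} [Fintype ι] (u : ι → E) (c : ι → ℝ) :
    ∑ i, (c i)⁺ • u i - ∑ j, (c j)⁻ • u j = ∑ i, c i • u i := by
  rw [← Finset.sum_sub_distrib]
  refine Finset.sum_congr rfl fun i _ => ?_
  rw [← sub_smul, posPart_sub_negPart]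

/-- In a linear relation the positive and negative parts are the same vector, whose square norm is
then nonpositive. So both parts vanish, and `h` reads off that their nonnegative coefficients sum to
zero. -/
theorem linearIndependent_of_inner_nonpos {ι : Type*} [Fintype ι] {u : ι → E}
    (hu : ∀ i j, i ≠ j → ⟪u i, u j⟫_ℝ ≤ 0) {h : E →ₗ[ℝ] ℝ} (hh : ∀ i, h (u i) = 1) :
    LinearIndependent ℝ u := by
  rw [Fintype.linearIndependent_iff]
  intro c hc
  have h1 := inner_sum_posPart_sum_negPart_nonpos hu c
  have h2 := sum_posPart_sub_sum_negPart u c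
  rw [hc, sub_eq_zero] at h2
  rw [← h2, real_inner_self_nonpos] at h1
  have h3 : ∑ i, (c i)⁻ • u i = 0 := by rw [← h2, h1]
  have h4 := congrArg h h1
  have h5 := congrArg h h3
  simp only [map_sum, map_smul, hh, smul_eq_mul, mul_one, map_zero] at h4 h5
  rw [Finset.sum_eq_zero_iff_of_nonneg fun i _ => posPart_nonneg _] at h4
  rw [Finset.sum_eq_zero_iff_of_nonneg fun i _ => negPart_nonneg _] at h5
  intro i
  rw [← posPart_sub_negPart (c i), h4 i (Finset.mem_univ i), h5 i (Finset.mem_univ i), sub_zero]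

/-- Projecting away from a family with nonpositive inner products does not increase inner
products. -/
theorem inner_starProjection_orthogonal_le [FiniteDimensional ℝ E] {T : Set E} (hT : T.Finite)
    {K : Submodule ℝ E} (hK : K = Submodule.span ℝ T)
    (hTT : ∀ s ∈ T, ∀ t ∈ T, s ≠ t → ⟪s, t⟫_ℝ ≤ 0) {a b : E}
    (ha : ∀ t ∈ T, ⟪a, t⟫_ℝ ≤ 0) (hb : ∀ t ∈ T, ⟪b, t⟫_ℝ ≤ 0) :
    ⟪Kᗮ.starProjection a, Kᗮ.starProjection b⟫_ℝ ≤ ⟪a, b⟫_ℝ := by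
  have := hT.fintype
  set q := K.starProjection a with hq
  have hqK : q ∈ K := Submodule.starProjection_apply_mem K a
  have hqt : ∀ t ∈ T, ⟪q, t⟫_ℝ ≤ 0 := by
    intro t ht
    have h1 : ⟪a - q, t⟫_ℝ = 0 :=
      Submodule.starProjection_inner_eq_zero a t (hK ▸ Submodule.subset_span ht)
    rw [inner_sub_left] at h1
    have := ha t ht
    linarith
  have h1 : q ∈ Submodule.span ℝ (Set.range ((↑) : T → E)) := by
    rwa [Subtype.range_coe, ← hK]
  obtain ⟨c, hc⟩ := (Submodule.mem_span_range_iff_exists_fun ℝ).1 h1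
  have h2 := inner_sum_posPart_sum_negPart_nonpos (u := ((↑) : T → E))
    (fun i j hij => hTT i i.2 j j.2 fun h => hij (Subtype.ext h)) c
  have h3 := sum_posPart_sub_sum_negPart ((↑) : T → E) c
  rw [hc] at h3
  set p := ∑ i : T, (c i)⁺ • (i : E) with hp
  set n := ∑ i : T, (c i)⁻ • (i : E) with hn
  -- With `q = p - n`, the bounds `⟪q, p⟫ ≤ 0` and `⟪n, p⟫ ≤ 0` give `‖p‖ ^ 2 ≤ 0`. Hence `q = -n`:
  -- the projection to `K` is a nonpositive combination of `T`.
  have h4 : ⟪q, p⟫_ℝ ≤ 0 := by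
    rw [hp, inner_sum]
    refine Finset.sum_nonpos fun i _ => ?_
    rw [inner_smul_right]
    exact mul_nonpos_of_nonneg_of_nonpos (posPart_nonneg _) (hqt i i.2)
  have h5 : p = 0 := by
    rw [← h3, inner_sub_left, real_inner_comm p n] at h4
    rw [← real_inner_self_nonpos]
    linarith
  have h6 : ⟪n, b⟫_ℝ ≤ 0 := by
    rw [hn, sum_inner]
    refine Finset.sum_nonpos fun i _ => ?_
    rw [inner_smul_left, real_inner_comm]
    exact mul_nonpos_of_nonneg_of_nonpos (negPart_nonneg _) (hb i i.2)
  have h7 : Kᗮ.starProjection a = a + n := by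
    rw [Submodule.starProjection_orthogonal_val, ← hq, ← h3, h5]; abel
  have h8 : ⟪Kᗮ.starProjection a, Kᗮ.starProjection b⟫_ℝ = ⟪Kᗮ.starProjection a, b⟫_ℝ := by
    rw [← Submodule.inner_starProjection_left_eq_right,
      Submodule.starProjection_eq_self_iff.2 (Submodule.starProjection_apply_mem _ _)]
  rw [h8, h7, inner_add_left]
  linarith

end Nonpositive

/-! ### Angles and signs of inner products -/

section Angle

variable {E : Type*} [NormedAddCommGroup E] [InnerProductSpace ℝ E]

/-- Zero vectors need no exclusion: their angle with anything is `π / 2` by convention. -/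
theorem pi_div_two_le_angle_iff {x y : E} :
    Real.pi / 2 ≤ InnerProductGeometry.angle x y ↔ ⟪x, y⟫_ℝ ≤ 0 := by
  rw [← not_lt, ← not_lt, not_iff_not, InnerProductGeometry.angle, Real.arccos_lt_pi_div_two]
  refine ⟨fun h => ?_, fun h => ?_⟩
  · by_contra! hc
    exact absurd (div_nonpos_of_nonpos_of_nonneg hc (by positivity : 0 ≤ ‖x‖ * ‖y‖)) (not_le.2 h)
  · have hx : x ≠ 0 := by rintro rfl; simp at h
    have hy : y ≠ 0 := by rintro rfl; simp at h
    positivity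

theorem pi_div_two_lt_angle_iff {x y : E} :
    Real.pi / 2 < InnerProductGeometry.angle x y ↔ ⟪x, y⟫_ℝ < 0 := by
  rw [lt_iff_le_and_ne, pi_div_two_le_angle_iff, lt_iff_le_and_ne, ne_eq, ne_eq, eq_comm,
    InnerProductGeometry.inner_eq_zero_iff_angle_eq_pi_div_two]

end Angle

/-! ### Faces of polytopes and tangent cones at vertices -/

variable {E : Type*} [NormedAddCommGroup E] [InnerProductSpace ℝ E]

theorem IsFace.subset {P F : Set E} (hF : IsFace P F) : F ⊆ P := hF.2.subset

theorem IsFace.exists_functional {P F : Set E} (hF : IsFace P F) {v : E} (hv : v ∈ F) :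
    ∃ k : E →ₗ[ℝ] ℝ, (∀ x ∈ P, 0 ≤ k (x - v)) ∧ F = {x ∈ P | k (x - v) = 0} := by
  obtain ⟨l, rfl⟩ := hF.2 hF.1
  refine ⟨-l.toLinearMap, fun x hx => ?_, Set.ext fun x => ?_⟩
  · simpa using hv.2 x hx
  · refine and_congr_right fun hx => ⟨fun h => ?_, fun h y hy => ?_⟩
    · have h1 := h v hv.1
      have h2 := hv.2 x hx
      simp; linarith
    · have h1 := hv.2 y hy
      simp at h
      linarith

/-- A point `v` of maximal norm is the only maximizer of `⟪v, ·⟫`. -/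
theorem exists_isFace_singleton {P : Set E} (hP : IsCompact P) (hne : P.Nonempty) :
    ∃ v, IsFace P {v} := by
  obtain ⟨v, hv, hmax⟩ := hP.exists_isMaxOn hne (continuous_norm.continuousOn)
  have key : ∀ x ∈ P, ‖x - v‖ ^ 2 ≤ 2 * (‖v‖ ^ 2 - ⟪v, x⟫_ℝ) := by
    intro x hx
    have h1 : ‖x‖ ≤ ‖v‖ := hmax hx
    have h2 : ‖x‖ ^ 2 ≤ ‖v‖ ^ 2 := by gcongr
    rw [norm_sub_sq_real, real_inner_comm]
    linarith
  refine ⟨v, ⟨v, rfl⟩, fun _ => ⟨innerSL ℝ v, Set.ext fun x => ?_⟩⟩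
  simp only [Set.mem_singleton_iff, innerSL_apply_apply, Set.mem_ofPred_eq]
  constructor
  · rintro rfl
    refine ⟨hv, fun y hy => ?_⟩
    have h1 := (sq_nonneg _).trans (key y hy)
    rw [real_inner_self_eq_norm_sq]
    linarith
  · rintro ⟨hx, h⟩
    have h1 := h v hv
    have h2 := key x hx
    rw [real_inner_self_eq_norm_sq] at h1
    have h3 : ‖x - v‖ ^ 2 = 0 := le_antisymm (by linarith) (sq_nonneg _)
    simpa [sub_eq_zero] using h3

theorem IsPolytope.isCompact {P : Set E} (hP : IsPolytope P) : IsCompact P := by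
  obtain ⟨s, rfl⟩ := hP
  exact s.finite_toSet.isCompact_convexHull ℝ

/-- Extreme points of an exposed face are extreme in `P`, hence lie in `s`. By Krein–Milman they
generate the face, and the hull of finitely many points is already closed. -/
theorem IsPolytope.of_isFace {P F : Set E} (hP : IsPolytope P) (hF : IsFace P F) :
    IsPolytope F := by
  have hFc : IsCompact F := hF.2.isCompact hP.isCompact
  obtain ⟨s, rfl⟩ := hP
  have hFconv : Convex ℝ F := hF.2.convex (convex_convexHull ℝ _)
  have hsub : F.extremePoints ℝ ⊆ s :=
    hF.2.isExtreme.extremePoints_subset_extremePoints.trans extremePoints_convexHull_subset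
  have hfin : (F.extremePoints ℝ).Finite := s.finite_toSet.subset hsub
  refine ⟨hfin.toFinset, ?_⟩
  rw [hfin.coe_toFinset]
  conv_lhs => rw [← closure_convexHull_extremePoints hFc hFconv]
  exact (hfin.isClosed_convexHull ℝ).closure_eq

theorem convexHull_sub_nonneg {s : Set E} {k : E →ₗ[ℝ] ℝ} {v : E}
    (hk : ∀ x ∈ s, 0 ≤ k (x - v)) : ∀ x ∈ convexHull ℝ s, 0 ≤ k (x - v) := by
  have hconv : Convex ℝ {x | 0 ≤ k (x - v)} := by
    simp_rw [map_sub, sub_nonneg]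
    exact convex_halfSpace_ge k.isLinear _
  exact convexHull_min hk hconv

/-- `S` generates the tangent cone of `P` at `v`, and lies at height one with respect to `h`. -/
structure IsConeAt (P : Set E) (v : E) (S : Set E) (h : E →ₗ[ℝ] ℝ) : Prop where
  mem : v ∈ P
  finite : S.Finite
  height : ∀ y ∈ S, h y = 1
  sub_mem : ∀ x ∈ P, x - v ∈ cone S
  exists_mem : ∀ y ∈ S, ∃ c : ℝ, 0 < c ∧ v + c • y ∈ P

/-- The functional exposing `v` is positive on `x - v` for every other generator `x` of `P`, so it
serves to rescale these vectors to height one. -/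
theorem IsPolytope.exists_isConeAt {P : Set E} (hP : IsPolytope P) {v : E}
    (hv : IsFace P {v}) : ∃ S h, IsConeAt P v S h := by
  obtain ⟨h, hh, hh0⟩ := hv.exists_functional rfl
  obtain ⟨s, rfl⟩ := hP
  have hvP : v ∈ convexHull ℝ (s : Set E) := hv.subset rfl
  have hpos : ∀ x ∈ s, x ≠ v → 0 < h (x - v) := by
    intro x hx hxv
    have hx' := subset_convexHull ℝ (s : Set E) hx
    refine lt_of_le_of_ne (hh x hx') fun h0 => hxv ?_
    have : x ∈ ({v} : Set E) := by rw [hh0]; exact ⟨hx', h0.symm⟩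
    exact this
  refine ⟨(fun x => (h (x - v))⁻¹ • (x - v)) '' {x | x ∈ s ∧ x ≠ v}, h, hvP,
    (s.finite_toSet.subset fun x hx => hx.1).image _, ?_, ?_, ?_⟩
  · rintro _ ⟨x, ⟨hx, hxv⟩, rfl⟩
    rw [map_smul, smul_eq_mul, inv_mul_cancel₀ (hpos x hx hxv).ne']
  · set S := (fun x => (h (x - v))⁻¹ • (x - v)) '' {x | x ∈ s ∧ x ≠ v}
    have hconv : Convex ℝ {x | x - v ∈ cone S} := by
      intro x hx y hy a b ha hb hab
      have := add_mem (smul_mem_cone ha hx) (smul_mem_cone hb hy)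
      rwa [show a • (x - v) + b • (y - v) = a • x + b • y - (a + b) • v by module, hab,
        one_smul] at this
    refine convexHull_min (fun x hx => ?_) hconv
    change x - v ∈ cone S
    by_cases hxv : x = v
    · simp [hxv]
    · have h1 := smul_mem_cone (hpos x hx hxv).le
        (Submodule.subset_span (R := ℝ≥0) (show _ ∈ S from ⟨x, ⟨hx, hxv⟩, rfl⟩))
      simpa only [smul_inv_smul₀ (hpos x hx hxv).ne'] using h1
  · rintro _ ⟨x, ⟨hx, hxv⟩, rfl⟩
    refine ⟨h (x - v), hpos x hx hxv, ?_⟩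
    rw [smul_inv_smul₀ (hpos x hx hxv).ne', add_sub_cancel]
    exact subset_convexHull ℝ (s : Set E) hx

/-! ### Faces through a vertex, read off in the tangent cone -/

namespace IsConeAt

variable {P S : Set E} {v : E} {h : E →ₗ[ℝ] ℝ}

theorem nonneg_iff (L : IsConeAt P v S h) {k : E →ₗ[ℝ] ℝ} :
    (∀ x ∈ P, 0 ≤ k (x - v)) ↔ ∀ y ∈ S, 0 ≤ k y := by
  refine ⟨fun hk y hy => ?_, fun hk x hx => cone_nonneg hk (L.sub_mem x hx)⟩
  obtain ⟨c, hc, hcP⟩ := L.exists_mem y hy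
  have := hk _ hcP
  rw [add_sub_cancel_left, map_smul, smul_eq_mul] at this
  exact nonneg_of_mul_nonneg_right this hc

theorem direction_face (L : IsConeAt P v S h) {k : E →ₗ[ℝ] ℝ} (hk : ∀ y ∈ S, 0 ≤ k y) :
    (affineSpan ℝ {x ∈ P | k (x - v) = 0}).direction
      = Submodule.span ℝ {y ∈ S | k y = 0} := by
  have hv : v ∈ {x ∈ P | k (x - v) = 0} := ⟨L.mem, by simp⟩
  rw [direction_affineSpan, vectorSpan_eq_span_vsub_set_right ℝ hv]
  refine le_antisymm (Submodule.span_le.2 ?_) (Submodule.span_le.2 ?_)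
  · rintro _ ⟨x, ⟨hx, hx0⟩, rfl⟩
    exact mem_span_of_mem_cone (mem_cone_ker hk (L.sub_mem x hx) hx0)
  · rintro y ⟨hy, hy0⟩
    obtain ⟨c, hc, hcP⟩ := L.exists_mem y hy
    rw [SetLike.mem_coe, ← Submodule.smul_mem_iff _ hc.ne']
    exact Submodule.subset_span ⟨_, ⟨hcP, by simp [hy0]⟩, by simp⟩

theorem dim_face (L : IsConeAt P v S h) {k : E →ₗ[ℝ] ℝ} (hk : ∀ y ∈ S, 0 ≤ k y) :
    dim {x ∈ P | k (x - v) = 0} = Module.finrank ℝ (Submodule.span ℝ {y ∈ S | k y = 0}) := by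
  rw [dim, L.direction_face hk]

theorem dim_eq (L : IsConeAt P v S h) : dim P = Module.finrank ℝ (Submodule.span ℝ S) := by
  have h0 := L.dim_face (k := 0) (by simp)
  have hsep : {x ∈ P | (0 : E →ₗ[ℝ] ℝ) (x - v) = 0} = P :=
    Set.sep_eq_self_iff_mem_true.2 fun _ _ => rfl
  have hsep' : {x ∈ S | (0 : E →ₗ[ℝ] ℝ) x = 0} = S :=
    Set.sep_eq_self_iff_mem_true.2 fun _ _ => rfl
  rwa [hsep, hsep'] at h0

theorem rays (L : IsConeAt P v S h) : IsConeAt P v {y | IsRay S y} h where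
  mem := L.mem
  finite := L.finite.subset fun _ hy => hy.1
  height y hy := L.height y hy.1
  sub_mem x hx := mem_cone_of_subset_cone
    (fun y hy => mem_cone_rays L.finite (fun z hz => by rw [L.height z hz]; exact one_pos) hy)
    (L.sub_mem x hx)
  exists_mem y hy := L.exists_mem y hy.1

/-- Turns dimensions of faces through `v` into numbers of generators. -/
theorem finrank_span_sep (L : IsConeAt P v S h)
    (hS : ∀ x ∈ S, ∀ y ∈ S, x ≠ y → ⟪x, y⟫_ℝ ≤ 0) {T : Set E} (hT : T ⊆ S) :
    Module.finrank ℝ (Submodule.span ℝ T) = T.ncard := by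
  have := (L.finite.subset hT).fintype
  have h1 : LinearIndependent ℝ ((↑) : T → E) :=
    linearIndependent_of_inner_nonpos
      (fun i j hij => hS i (hT i.2) j (hT j.2) fun h => hij (Subtype.ext h))
      (h := h) fun i => L.height i (hT i.2)
  have h2 := finrank_span_eq_card h1
  rwa [Subtype.range_coe, ← Nat.card_eq_fintype_card, Nat.card_coe_set_eq] at h2

end IsConeAt

/-! ### Faces of faces, and dihedral angles at a vertex -/

variable [FiniteDimensional ℝ E]

theorem isFace_of_nonneg {P : Set E} {v : E} (hv : v ∈ P) {k : E →ₗ[ℝ] ℝ}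
    (hk : ∀ x ∈ P, 0 ≤ k (x - v)) : IsFace P {x ∈ P | k (x - v) = 0} := by
  refine ⟨⟨v, hv, by simp⟩, fun _ => ⟨-LinearMap.toContinuousLinearMap k, Set.ext fun x => ?_⟩⟩
  refine and_congr_right fun hx => ⟨fun h y hy => ?_, fun h => ?_⟩
  · have := hk y hy
    simp at this h ⊢
    linarith
  · have h1 := h v hv
    have h2 := hk x hx
    simp at h1 h2 ⊢
    linarith

theorem IsPolytope.isFace_trans {P F G : Set E} (hP : IsPolytope P) (hF : IsFace P F)
    (hG : IsFace F G) : IsFace P G := by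
  obtain ⟨v, hv⟩ := hG.1
  have hvF := hG.subset hv
  have hvP := hF.subset hvF
  obtain ⟨k, hk, rfl⟩ := hF.exists_functional hvF
  obtain ⟨l, hl, rfl⟩ := hG.exists_functional hv
  obtain ⟨s, rfl⟩ := hP
  obtain ⟨M, hM⟩ := exists_forall_pos_mul_add s.finite_toSet
    (fun x => k (x - v)) (fun x => l (x - v))
  have h1 : ∀ x ∈ convexHull ℝ (s : Set E), 0 ≤ (M • k + l) (x - v) := by
    refine convexHull_sub_nonneg fun x hx => ?_
    have hx' := subset_convexHull ℝ (s : Set E) hx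
    rcases (hk x hx').eq_or_lt with h0 | h0
    · have := hl x ⟨hx', h0.symm⟩
      simpa only [LinearMap.add_apply, LinearMap.smul_apply, ← h0, smul_zero, zero_add] using this
    · simpa only [LinearMap.add_apply, LinearMap.smul_apply, smul_eq_mul] using (hM x hx h0).le
  have h2 : ∀ x, (M • k + l + k) (x - v) = (M • k + l) (x - v) + k (x - v) := fun x => rfl
  have h3 : ∀ x, (M • k + l) (x - v) = M * k (x - v) + l (x - v) := fun x => rfl
  -- `M • k + l` is known to be only nonnegative on the hull; the additional `k` makes vanishing of
  -- the sum force `k (x - v) = 0`.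
  convert isFace_of_nonneg hvP (k := M • k + l + k) fun x hx => ?_ using 1
  · ext x
    simp only [Set.mem_ofPred_eq, h2]
    constructor
    · rintro ⟨⟨hx, h4⟩, h5⟩
      exact ⟨hx, by rw [h3, h4, h5]; ring⟩
    · rintro ⟨hx, h0⟩
      have h4 : k (x - v) = 0 := le_antisymm (by linarith [h1 x hx]) (hk x hx)
      refine ⟨⟨hx, h4⟩, ?_⟩
      rwa [h3, h4, mul_zero, zero_add, add_zero] at h0
  · rw [h2]
    exact add_nonneg (h1 x hx) (hk x hx)

theorem IsConeAt.isFace {P S : Set E} {v : E} {h : E →ₗ[ℝ] ℝ} (L : IsConeAt P v S h)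
    {k : E →ₗ[ℝ] ℝ} (hk : ∀ y ∈ S, 0 ≤ k y) : IsFace P {x ∈ P | k (x - v) = 0} :=
  isFace_of_nonneg L.mem (L.nonneg_iff.2 hk)

/-- Edges at `v` spanning a two-dimensional face enclose a dihedral angle of that face. -/
theorem IsConeAt.exists_isDihedralAngleOf {P S : Set E} {v : E} {h : E →ₗ[ℝ] ℝ}
    (L : IsConeAt P v S h) {y w : E} (hy : IsRay S y) (hw : w ∈ rayNeighbors S y) :
    ∃ F, IsFace P F ∧ dim F = 2 ∧ IsDihedralAngleOf F (InnerProductGeometry.angle y w) := by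
  obtain ⟨hw, hwy, k, hk, hky, hkw, hk2⟩ := hw
  have hdim : dim {x ∈ P | k (x - v) = 0} = 2 := by rw [L.dim_face hk, hk2]
  set F := {x ∈ P | k (x - v) = 0} with hF
  have hvF : v ∈ F := ⟨L.mem, by simp⟩
  have edge : ∀ z, IsRay S z → k z = 0 → ∃ l : E →ₗ[ℝ] ℝ, (∀ x ∈ F, 0 ≤ l (x - v)) ∧
      dim {x ∈ F | l (x - v) = 0} = 1 ∧ l z = 0 ∧ ∀ x ∈ S, l x = 0 → x = z := by
    rintro z ⟨hzS, l, hl, hlz, hl0⟩ hkz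
    have hl0' : ∀ x ∈ S, l x = 0 → x = z := fun x hx h0 =>
      eq_of_mem_span_singleton (L.height x hx) (L.height z hzS) (hl0 x hx h0)
    refine ⟨l, fun x hx => L.nonneg_iff.2 hl x hx.1, ?_, hlz, hl0'⟩
    -- The edge of `F` is viewed as a face of `P`, so that its dimension is computed from `S`, where
    -- `k + l` vanishes only at `z`.
    have h1 : {x ∈ F | l (x - v) = 0} = {x ∈ P | (k + l) (x - v) = 0} := by
      ext x
      simp only [hF, Set.mem_ofPred_eq, LinearMap.add_apply, and_assoc]
      refine and_congr_right fun hx => ?_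
      rw [add_eq_zero_iff_of_nonneg (L.nonneg_iff.2 hk x hx) (L.nonneg_iff.2 hl x hx)]
    have h2 : {x ∈ S | (k + l) x = 0} = {z} := by
      ext x
      simp only [Set.mem_ofPred_eq, LinearMap.add_apply, Set.mem_singleton_iff]
      constructor
      · rintro ⟨hx, h0⟩
        exact hl0' x hx ((add_eq_zero_iff_of_nonneg (hk x hx) (hl x hx)).1 h0).2
      · rintro rfl
        exact ⟨hzS, by rw [hkz, hlz, add_zero]⟩
    have hz0 : z ≠ 0 := by
      rintro rfl
      simpa using L.height 0 hzS
    rw [h1, L.dim_face fun x hx => add_nonneg (hk x hx) (hl x hx), h2, finrank_span_singleton hz0]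
  obtain ⟨l, hl, hl1, hly, hl0⟩ := edge y hy hky
  obtain ⟨m, hm, hm1, hmw, hm0⟩ := edge w hw hkw
  obtain ⟨c, hc, hcP⟩ := L.exists_mem y hy.1
  obtain ⟨d, hd, hdP⟩ := L.exists_mem w hw.1
  have hyF : v + c • y ∈ {x ∈ F | l (x - v) = 0} := ⟨⟨hcP, by simp [hky]⟩, by simp [hly]⟩
  have hwF : v + d • w ∈ {x ∈ F | m (x - v) = 0} := ⟨⟨hdP, by simp [hkw]⟩, by simp [hmw]⟩
  have hG : IsFace F {v} := by
    have h1 := isFace_of_nonneg hvF (k := h) fun x hx =>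
      L.nonneg_iff.2 (fun y hy => by rw [L.height y hy]; exact zero_le_one) x hx.1
    have h2 : {x ∈ F | h (x - v) = 0} = {v} := by
      refine Set.Subset.antisymm (fun x hx => ?_) ?_
      · rcases cone_pos (l := h) (fun y hy => by rw [L.height y hy]; exact one_pos)
          (L.sub_mem x hx.1.1) with h3 | h3
        · exact sub_eq_zero.1 h3
        · exact absurd hx.2 h3.ne'
      · rintro x rfl
        exact ⟨hvF, by simp⟩
    rwa [h2] at h1
  have hy0 : y ≠ 0 := by rintro rfl; simpa using L.height 0 hy.1
  have hw0 : w ≠ 0 := by rintro rfl; simpa using L.height 0 hw.1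
  have hdir : (affineSpan ℝ {v}).direction = (⊥ : Submodule ℝ E) := by
    rw [direction_affineSpan, vectorSpan_singleton]
  -- At a vertex there is nothing to project away: the dihedral angle of a 2-face is its plane
  -- angle.
  have hproj : ∀ x : E, (affineSpan ℝ {v}).directionᗮ.starProjection x = x := fun x => by
    rw [Submodule.starProjection_eq_self_iff, hdir, Submodule.bot_orthogonal_eq_top]
    trivial
  refine ⟨F, L.isFace hk, hdim, {v}, _, _, hG, ?_, isFace_of_nonneg hvF hl, by rw [hl1, hdim],
    isFace_of_nonneg hvF hm, by rw [hm1, hdim], ?_, ?_, ?_, v, rfl, v + c • y, ⟨hyF, ?_⟩,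
    v + d • w, ⟨hwF, ?_⟩, ?_⟩
  · rw [hdim, dim, hdir, finrank_bot]
  · intro heq
    rw [heq] at hyF
    have := hyF.2
    rw [add_sub_cancel_left, map_smul, smul_eq_mul, mul_eq_zero] at this
    exact hwy (hm0 y hy.1 (this.resolve_left hc.ne')).symm
  · rintro x rfl; exact ⟨hvF, by simp⟩
  · rintro x rfl; exact ⟨hvF, by simp⟩
  · simp [hc.ne', hy0]
  · simp [hd.ne', hw0]
  · rw [hproj, hproj, add_sub_cancel_left, add_sub_cancel_left,
      InnerProductGeometry.angle_smul_left_of_pos _ _ hc,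
      InnerProductGeometry.angle_smul_right_of_pos _ _ hd]

/-- At a vertex whose edges pairwise enclose non-acute angles, each dihedral angle is the angle
between two vectors whose inner product is at most that of two edge directions. -/
theorem IsConeAt.exists_pair_of_isDihedralAngle {P S : Set E} {v : E} {h : E →ₗ[ℝ] ℝ}
    (L : IsConeAt P v S h) (hS : ∀ x ∈ S, ∀ y ∈ S, x ≠ y → ⟪x, y⟫_ℝ ≤ 0)
    {G F₁ F₂ : Set E} (hvG : v ∈ G) (hG : IsFace P G) (hGd : dim G + 2 = dim P)
    (hF₁ : IsFace P F₁) (hFd₁ : dim F₁ + 1 = dim P) (hF₂ : IsFace P F₂)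
    (hFd₂ : dim F₂ + 1 = dim P) (hne : F₁ ≠ F₂) (hG₁ : G ⊆ F₁) (hG₂ : G ⊆ F₂) {θ : ℝ}
    (hθ : IsDihedralAngle G F₁ F₂ θ) :
    ∃ a ∈ S, ∃ b ∈ S, a ≠ b ∧ ∃ x y : E, ⟪x, y⟫_ℝ ≤ ⟪a, b⟫_ℝ ∧
      θ = InnerProductGeometry.angle x y := by
  obtain ⟨k, hk, rfl⟩ := hG.exists_functional hvG
  obtain ⟨k₁, hk₁, rfl⟩ := hF₁.exists_functional (hG₁ hvG)
  obtain ⟨k₂, hk₂, rfl⟩ := hF₂.exists_functional (hG₂ hvG)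
  rw [L.nonneg_iff] at hk hk₁ hk₂
  rw [L.dim_eq, L.finrank_span_sep hS subset_rfl] at hGd hFd₁ hFd₂
  rw [L.dim_face hk, L.finrank_span_sep hS (Set.sep_subset _ _)] at hGd
  rw [L.dim_face hk₁, L.finrank_span_sep hS (Set.sep_subset _ _)] at hFd₁
  rw [L.dim_face hk₂, L.finrank_span_sep hS (Set.sep_subset _ _)] at hFd₂
  have hdir := L.direction_face hk
  set A := {y ∈ S | k y = 0} with hA
  have hAfin : A.Finite := L.finite.subset (Set.sep_subset _ _)
  have hsub : ∀ l : E →ₗ[ℝ] ℝ, {x ∈ P | k (x - v) = 0} ⊆ {x ∈ P | l (x - v) = 0} →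
      A ⊆ {y ∈ S | l y = 0} := by
    rintro l hl y ⟨hy, hky⟩
    obtain ⟨c, hc, hcP⟩ := L.exists_mem y hy
    have h1 := (hl ⟨hcP, by simp [hky]⟩).2
    rw [add_sub_cancel_left, map_smul, smul_eq_mul, mul_eq_zero] at h1
    exact ⟨hy, h1.resolve_left hc.ne'⟩
  -- Dimensions count generators, so each facet has exactly one generator more than `G`.
  obtain ⟨a, haA, ha⟩ := (Set.exists_eq_insert_iff_ncard hAfin).2
    ⟨hsub k₁ hG₁, (by omega : A.ncard + 1 = {y ∈ S | k₁ y = 0}.ncard)⟩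
  obtain ⟨b, hbA, hb⟩ := (Set.exists_eq_insert_iff_ncard hAfin).2
    ⟨hsub k₂ hG₂, (by omega : A.ncard + 1 = {y ∈ S | k₂ y = 0}.ncard)⟩
  have haS : a ∈ S := (ha ▸ Set.mem_insert a A : a ∈ {y ∈ S | k₁ y = 0}).1
  have hbS : b ∈ S := (hb ▸ Set.mem_insert b A : b ∈ {y ∈ S | k₂ y = 0}).1
  have hface : ∀ l : E →ₗ[ℝ] ℝ, (∀ y ∈ S, 0 ≤ l y) → ∀ x ∈ P,
      (l (x - v) = 0 ↔ x - v ∈ cone {y ∈ S | l y = 0}) := by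
    refine fun l hl x hx => ⟨mem_cone_ker hl (L.sub_mem x hx), fun h1 => ?_⟩
    have h2 : Submodule.span ℝ {y ∈ S | l y = 0} ≤ LinearMap.ker l :=
      Submodule.span_le.2 fun y hy => hy.2
    exact h2 (mem_span_of_mem_cone h1)
  have hab : a ≠ b := by
    rintro rfl
    apply hne
    ext x
    refine and_congr_right fun hx => ?_
    rw [hface k₁ hk₁ x hx, hface k₂ hk₂ x hx, ← ha, ← hb]
  have hAa : ∀ c ∈ S, c ∉ A → ∀ t ∈ A, ⟪c, t⟫_ℝ ≤ 0 := fun c hcS hcA t ht =>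
    hS c hcS t ht.1 fun h1 => hcA (h1 ▸ ht)
  have hproj := inner_starProjection_orthogonal_le hAfin hdir
    (fun s hs t ht => hS s hs.1 t ht.1) (hAa a haS haA) (hAa b hbS hbA)
  obtain ⟨p, ⟨hpP, hpk⟩, x, ⟨⟨hxP, hxk⟩, hxG⟩, y, ⟨⟨hyP, hyk⟩, hyG⟩, rfl⟩ := hθ
  set K := (affineSpan ℝ {x ∈ P | k (x - v) = 0}).direction with hK
  have hp : p - v ∈ K := by
    rw [hdir]
    exact mem_span_of_mem_cone ((hface k hk p hpP).1 hpk)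
  -- Modulo the directions of `G`, a point of the facet outside `G` differs from `p` by a positive
  -- multiple of the one additional generator `c`.
  have hside : ∀ c z, z ∈ P → z ∉ {x ∈ P | k (x - v) = 0} → z - v ∈ cone (insert c A) →
      ∃ r : ℝ, 0 < r ∧ Kᗮ.starProjection (z - p) = r • Kᗮ.starProjection c := by
    intro c z hzP hzG hz
    obtain ⟨r, g, hg, hzg⟩ := Submodule.mem_span_insert.1 hz
    have hr : r ≠ 0 := by
      rintro rfl
      rw [zero_smul, zero_add] at hzg
      exact hzG ⟨hzP, (hface k hk z hzP).2 (hzg ▸ hg)⟩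
    refine ⟨r, by positivity, ?_⟩
    have hgK : g ∈ K := by
      rw [hdir]
      exact mem_span_of_mem_cone hg
    have h1 : z - p = (r : ℝ) • c + (g - (p - v)) := by
      rw [NNReal.smul_def] at hzg
      rw [← sub_sub_sub_cancel_right z p v, hzg]; abel
    have h2 : Kᗮ.starProjection (g - (p - v)) = 0 := by
      rw [Submodule.starProjection_apply_eq_zero_iff]
      exact Submodule.le_orthogonal_orthogonal K (K.sub_mem hgK hp)
    rw [h1, map_add, h2, add_zero, map_smul]
  obtain ⟨r, hr, hxr⟩ := hside a x hxP hxG (by rw [ha]; exact (hface k₁ hk₁ x hxP).1 hxk)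
  obtain ⟨s, hs, hys⟩ := hside b y hyP hyG (by rw [hb]; exact (hface k₂ hk₂ y hyP).1 hyk)
  refine ⟨a, haS, b, hbS, hab, _, _, hproj, ?_⟩
  rw [hxr, hys, InnerProductGeometry.angle_smul_left_of_pos _ _ hr,
      InnerProductGeometry.angle_smul_right_of_pos _ _ hs]

/-! ### From two-dimensional faces to all dihedral angles, and simplicity -/

theorem IsConeAt.inner_rays_nonpos {P S : Set E} {v : E} {h : E →ₗ[ℝ] ℝ}
    (L : IsConeAt P v S h)
    (H : ∀ F, IsFace P F → dim F = 2 → IsNonAcuteInCodimOne F) :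
    ∀ x ∈ {y | IsRay S y}, ∀ y ∈ {y | IsRay S y}, x ≠ y → ⟪x, y⟫_ℝ ≤ 0 := by
  refine fun x hx y hy hxy => hx.inner_nonpos L.finite L.height hy hxy fun w hw => ?_
  obtain ⟨F, hF, hF2, hθ⟩ := L.exists_isDihedralAngleOf hx hw
  exact pi_div_two_le_angle_iff.1 (H F hF hF2 _ hθ)

theorem IsConeAt.inner_rays_neg {P S : Set E} {v : E} {h : E →ₗ[ℝ] ℝ}
    (L : IsConeAt P v S h)
    (H : ∀ F, IsFace P F → dim F = 2 → IsObtuseInCodimOne F) :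
    ∀ x ∈ {y | IsRay S y}, ∀ y ∈ {y | IsRay S y}, x ≠ y → ⟪x, y⟫_ℝ < 0 := by
  refine fun x hx y hy hxy => hx.inner_neg L.finite L.height hy hxy fun w hw => ?_
  obtain ⟨F, hF, hF2, hθ⟩ := L.exists_isDihedralAngleOf hx hw
  exact pi_div_two_lt_angle_iff.1 (H F hF hF2 _ hθ)

/-- A vertex of `G` is a vertex of `P`, so the dihedral angle at `G` can be studied in the tangent
cone of `P` there. -/
theorem IsPolytope.exists_vertex_isConeAt {P G : Set E} (hP : IsPolytope P) (hG : IsFace P G) :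
    ∃ v ∈ G, ∃ S h, IsConeAt P v S h := by
  obtain ⟨v, hv⟩ := exists_isFace_singleton (hP.of_isFace hG).isCompact hG.1
  exact ⟨v, hv.subset rfl, hP.exists_isConeAt (hP.isFace_trans hG hv)⟩

theorem IsPolytope.isNonAcuteInCodimOne {P : Set E} (hP : IsPolytope P)
    (H : ∀ F, IsFace P F → dim F = 2 → IsNonAcuteInCodimOne F) : IsNonAcuteInCodimOne P := by
  rintro θ ⟨G, F₁, F₂, hG, hGd, hF₁, hd₁, hF₂, hd₂, hne, hG₁, hG₂, hθ⟩
  obtain ⟨v, hvG, S, h, L⟩ := hP.exists_vertex_isConeAt hG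
  have hR := L.inner_rays_nonpos H
  obtain ⟨a, ha, b, hb, hab, x, y, hxy, rfl⟩ := L.rays.exists_pair_of_isDihedralAngle hR hvG hG hGd
    hF₁ hd₁ hF₂ hd₂ hne hG₁ hG₂ hθ
  exact pi_div_two_le_angle_iff.2 (hxy.trans (hR a ha b hb hab))

theorem IsPolytope.isObtuseInCodimOne {P : Set E} (hP : IsPolytope P)
    (H : ∀ F, IsFace P F → dim F = 2 → IsObtuseInCodimOne F) : IsObtuseInCodimOne P := by
  rintro θ ⟨G, F₁, F₂, hG, hGd, hF₁, hd₁, hF₂, hd₂, hne, hG₁, hG₂, hθ⟩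
  obtain ⟨v, hvG, S, h, L⟩ := hP.exists_vertex_isConeAt hG
  have hR := L.inner_rays_neg H
  obtain ⟨a, ha, b, hb, hab, x, y, hxy, rfl⟩ := L.rays.exists_pair_of_isDihedralAngle
    (fun x hx y hy hxy => (hR x hx y hy hxy).le) hvG hG hGd
    hF₁ hd₁ hF₂ hd₂ hne hG₁ hG₂ hθ
  exact pi_div_two_lt_angle_iff.2 (hxy.trans_lt (hR a ha b hb hab))

theorem IsNonAcute.isSimple {P : Set E} (hP : IsPolytope P) (hN : IsNonAcute P) :
    IsSimple P := by
  intro v hv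
  obtain ⟨S, h, L⟩ := hP.exists_isConeAt hv
  have hR := L.inner_rays_nonpos fun F hF _ => hN.2 F hF
  set R := {y | IsRay S y} with hRdef
  have LR : IsConeAt P v R h := L.rays
  have hkeq : ∀ y ∈ R, ∀ k : E →ₗ[ℝ] ℝ, (∀ x ∈ R, 0 ≤ k x) → {x ∈ R | k x = 0} = {y} →
      {x ∈ P | k (x - v) = 0} = {x ∈ P | x - v ∈ Submodule.span ℝ {y}} := by
    intro y hy k hk hky
    ext x
    refine and_congr_right fun hx => ⟨fun h0 => ?_, fun h0 => ?_⟩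
    · rw [← hky]
      exact mem_span_of_mem_cone (mem_cone_ker hk (LR.sub_mem x hx) h0)
    · obtain ⟨c, hc⟩ := Submodule.mem_span_singleton.1 h0
      have : k y = 0 := (hky ▸ Set.mem_singleton y : y ∈ {x ∈ R | k x = 0}).2
      rw [← hc, map_smul, this, smul_zero]
  -- Edges at `v` correspond to rays: a 1-dimensional face contains exactly one ray direction by the
  -- dimension count, and each ray is exposed by its own functional.
  have hedges : {e : Set E | IsFace P e ∧ dim e = 1 ∧ v ∈ e}
      = (fun y => {x ∈ P | x - v ∈ Submodule.span ℝ {y}}) '' R := by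
    ext e
    constructor
    · rintro ⟨he, he1, hve⟩
      obtain ⟨k, hk, rfl⟩ := he.exists_functional hve
      rw [LR.nonneg_iff] at hk
      rw [LR.dim_face hk, LR.finrank_span_sep hR (Set.sep_subset _ _), Set.ncard_eq_one] at he1
      obtain ⟨y, hy⟩ := he1
      have hyR : y ∈ R := (hy ▸ Set.mem_singleton y : y ∈ {x ∈ R | k x = 0}).1
      exact ⟨y, hyR, (hkeq y hyR k hk hy).symm⟩
    · rintro ⟨y, hy, rfl⟩
      obtain ⟨hyS, l, hl, hly, hl0⟩ := id hy
      have hlR : ∀ x ∈ R, 0 ≤ l x := fun x hx => hl x hx.1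
      have hly' : {x ∈ R | l x = 0} = {y} := by
        refine Set.Subset.antisymm (fun x hx => ?_) ?_
        · exact eq_of_mem_span_singleton (LR.height x hx.1) (LR.height y hy) (hl0 x hx.1.1 hx.2)
        · rintro x rfl
          exact ⟨hy, hly⟩
      refine ⟨?_, ?_, ⟨LR.mem, by simp⟩⟩
      · simp only [← hkeq y hy l hlR hly']
        exact LR.isFace hlR
      · simp only [← hkeq y hy l hlR hly']
        rw [LR.dim_face hlR, hly', LR.finrank_span_sep hR (by simpa using hy), Set.ncard_singleton]
  have hinj : Set.InjOn (fun y => {x ∈ P | x - v ∈ Submodule.span ℝ {y}}) R := by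
    intro y hy z hz hyz
    obtain ⟨c, hc, hcP⟩ := LR.exists_mem y hy
    have h1 : v + c • y ∈ {x ∈ P | x - v ∈ Submodule.span ℝ {y}} :=
      ⟨hcP, by rw [add_sub_cancel_left]; exact Submodule.mem_span_singleton.2 ⟨c, rfl⟩⟩
    have h2 : v + c • y ∈ {x ∈ P | x - v ∈ Submodule.span ℝ {z}} := by
      simpa only [hyz] using h1
    have h3 := h2.2
    rw [add_sub_cancel_left, Submodule.smul_mem_iff _ hc.ne'] at h3
    exact eq_of_mem_span_singleton (LR.height y hy) (LR.height z hz) h3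
  rw [hedges, hinj.encard_image, LR.dim_eq, LR.finrank_span_sep hR subset_rfl,
    LR.finite.cast_ncard_eq]

end EuclideanPolytope

theorem mainTheorem12 {E : Type*} [NormedAddCommGroup E] [InnerProductSpace ℝ E]
    [FiniteDimensional ℝ E] (P : Set E) (hP : EuclideanPolytope.IsPolytope P) :
    (EuclideanPolytope.IsNonAcute P ↔
      ∀ F : Set E, EuclideanPolytope.IsFace P F → EuclideanPolytope.dim F = 2 →
        EuclideanPolytope.IsNonAcute F) ∧
    (EuclideanPolytope.IsObtuse P ↔
      ∀ F : Set E, EuclideanPolytope.IsFace P F → EuclideanPolytope.dim F = 2 →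
        EuclideanPolytope.IsObtuse F) ∧
    (EuclideanPolytope.IsNonAcute P → EuclideanPolytope.IsSimple P) := by
  refine ⟨⟨fun h F hF _ => ⟨h.2 F hF, fun G hG => h.2 G (hP.isFace_trans hF hG)⟩, fun h => ?_⟩,
    ⟨fun h F hF _ => ⟨h.2 F hF, fun G hG => h.2 G (hP.isFace_trans hF hG)⟩, fun h => ?_⟩,
    fun h => h.isSimple hP⟩
  -- The codimension 1 criterion applies to each face `Q` as well, whose 2-faces are 2-faces of `P`.
  · exact ⟨hP.isNonAcuteInCodimOne fun F hF hd => (h F hF hd).1, fun Q hQ =>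
      (hP.of_isFace hQ).isNonAcuteInCodimOne fun F hF hd => (h F (hP.isFace_trans hQ hF) hd).1⟩
  · exact ⟨hP.isObtuseInCodimOne fun F hF hd => (h F hF hd).1, fun Q hQ =>
      (hP.of_isFace hQ).isObtuseInCodimOne fun F hF hd => (h F (hP.isFace_trans hQ hF) hd).1⟩
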